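/- Let $\mathbb{X}$ be a Borel space (a topological space homeomorphic to a Borel subset of a Polish space) and let $\mathbb{A}$ be a countable space with the discrete topology. Consider a Markov decision process with state space $\mathbb{X}$, action space $\mathbb{A}$, nonempty admissible action sets $A(x)\subset\mathbb{A}$, $x\in\mathbb{X}$, whose graph $\Gamma=\{(x,a) : x\in\mathbb{X},\ a\in A(x)\}$ is Borel, Borel measurable one-stage cost $c:\Gamma\to[0,+\infty]$, and Borel measurable transition kernel $q(dy\mid x,a)$ on $\mathbb{X}$ given $\mathbb{X}\times\mathbb{A}$. Extend $c$ to $\mathbb{X}\times\mathbb{A}$ by $c=+\infty$ outside $\Gamma$. A policy $\pi=(\mu_0,\mu_1,\ldots)$ is a sequence of Borel measurable stochastic kernels $\mu_k(da_k\mid x_0,a_0,\ldots,a_{k-1},x_k)$ on $\mathbb{A}$ with $\mu_k(A(x_k)\mid x_0,a_0,\ldots,a_{k-1},x_k)=1$ for all histories; it is stationary if $\mu_k(\cdot\mid x_0,a_0,\ldots,a_{k-1},x_k)=\mu(\cdot\mid x_k)$ for all $k$ and one kernel $\mu$. For a policy $\pi$ and a Borel probability measure $p$ on $\mathbb{X}$,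 the average cost is $$J(\pi,p)=\limsup_{n\to\infty}\frac1n\,\mathbb{E}^\pi_p\Big[\sum_{k=0}^{n-1}c(x_k,a_k)\Big],$$ where the expectation is with respect to the law of $(x_k,a_k)_{k\ge 0}$ determined by $\pi$, $q$ and the initial distribution $p$ of $x_0$; $J(\pi,x)=J(\pi,\delta_x)$. Assume: (G) $J(\pi,x)<\infty$ for some policy $\pi$ and some $x\in\mathbb{X}$. (SU) There are increasing sequences of compact sets $K_n\subset\mathbb{X}$ and $A_n\subset\mathbb{A}$ with $\lim_{n\to\infty}\inf_{(x,a)\notin K_n\times A_n}c(x,a)=+\infty$. (M) For each $K\in\{K_n\}$ there are an open set $O\supset K$, a closed (possibly empty) set $D\subset\mathbb{X}$ and a finite Borel measure $\nu$ on $\mathbb{X}$ such that $$q\big((O\setminus D)\cap B\mid x,a\big)\le\nu(B)\qquad\text{for all Borel } B\subset\mathbb{X},\ (x,a)\in\Gamma,$$ and such that, restricted to $D\times\mathbb{A}$, the map $(x,a)\mapsto q(\cdot\mid x,a)$ is continuous for the topology of weak convergence and the (extended) cost $c$ is lower semicontinuous. Then for every policy $\pi$ and every Borel probability measure $p$ on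 $\mathbb{X}$ with $J(\pi,p)<\infty$ there exist a stationary policy $\bar\mu$ and a Borel probability measure $\bar p$ on $\mathbb{X}$ such that $\bar p$ is invariant for the Markov chain on $\mathbb{X}$ induced by $\bar\mu$, i.e. $\bar p(B)=\int_{\mathbb{X}}\int_{\mathbb{A}}q(B\mid x,a)\,\bar\mu(da\mid x)\,\bar p(dx)$ for all Borel $B\subset\mathbb{X}$, and $J(\bar\mu,\bar p)\le J(\pi,p)$. -/

import Mathlib

open MeasureTheory ProbabilityTheory Filter Topology
open scoped ENNReal

universe u v

/-- A topological space is a Borel space if it is homeomorphic to a Borel subset of a Polish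
space. -/
class IsTopBorelSpace (X : Type u) [TopologicalSpace X] : Prop where
  exists_isEmbedding : ∃ (Y : Type u) (_ : TopologicalSpace Y) (_ : PolishSpace Y) (f : X → Y),
    Topology.IsEmbedding f ∧ MeasurableSet[borel Y] (Set.range f)

/-- A nonnegative-cost Markov decision process with state space `X` and action space `A`:
`admissible x` is the set of actions available at `x`, the graph of this set-valued map is
measurable, the one-stage cost is a measurable `[0, ∞]`-valued function defined on the graph, and
`trans` is the state transition stochastic kernel on `X` given `X × A`. -/
structure MDP (X : Type u) (A : Type v) [MeasurableSpace X] [MeasurableSpace A] where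
  admissible : X → Set A
  admissible_nonempty : ∀ x, (admissible x).Nonempty
  measurableSet_graph : MeasurableSet {z : X × A | z.2 ∈ admissible z.1}
  cost : {z : X × A // z.2 ∈ admissible z.1} → ℝ≥0∞
  measurable_cost : Measurable cost
  trans : Kernel (X × A) X
  isMarkovKernel_trans : IsMarkovKernel trans

attribute [instance] MDP.isMarkovKernel_trans

namespace MDP

variable {X : Type u} {A : Type v} [MeasurableSpace X] [MeasurableSpace A]

/-- The graph `Γ` of the control constraint. -/
def graph (M : MDP X A) : Set (X × A) := {z | z.2 ∈ M.admissible z.1}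

open Classical in
/-- The one-stage cost as a function on all of `X × A`: it is `+∞` at inadmissible pairs. -/
noncomputable def extCost (M : MDP X A) (z : X × A) : ℝ≥0∞ :=
  if h : z.2 ∈ M.admissible z.1 then M.cost ⟨z, h⟩ else ⊤

/-- The transition kernel as a map into the space of probability measures, which carries the
topology of weak convergence. -/
noncomputable def transProb (M : MDP X A) (z : X × A) : ProbabilityMeasure X :=
  ⟨M.trans z, inferInstance⟩

/-- A Borel measurable (randomized, history-dependent) policy: for each stage `k` a stochastic
kernel on `A` given the history `((x₀, a₀), …, (xₖ₋₁, aₖ₋₁))` and the current state `xₖ`, which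
obeys the control constraint at every history. -/
structure Policy (M : MDP X A) where
  kernel : (k : ℕ) → Kernel ((Fin k → X × A) × X) A
  isMarkovKernel : ∀ k, IsMarkovKernel (kernel k)
  admissible : ∀ (k : ℕ) (h : Fin k → X × A) (x : X), kernel k (h, x) (M.admissible x) = 1

attribute [instance] Policy.isMarkovKernel

/-- A stationary policy, given by one stochastic kernel on `A` given `X`. -/
structure StationaryPolicy (M : MDP X A) where
  kernel : Kernel X A
  isMarkovKernel : IsMarkovKernel kernel
  admissible : ∀ x : X, kernel x (M.admissible x) = 1

attribute [instance] StationaryPolicy.isMarkovKernel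

/-- The policy `(μ, μ, …)` determined by a stationary policy `μ`. -/
noncomputable def StationaryPolicy.toPolicy {M : MDP X A} (μ : M.StationaryPolicy) :
    M.Policy where
  kernel _ := μ.kernel.comap Prod.snd measurable_snd
  isMarkovKernel _ := inferInstance
  admissible _ _ x := μ.admissible x

/-- The transition kernel `B ↦ ∫ q(B | x, a) μ(da | x)` of the Markov chain on `X` induced by a
stationary policy `μ`. -/
noncomputable def StationaryPolicy.chain {M : MDP X A} (μ : M.StationaryPolicy) : Kernel X X :=
  (μ.kernel ⊗ₖ M.trans).snd

/-- The law of `(x₀, a₀)` under a policy and an initial distribution. -/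
noncomputable def Policy.initial {M : MDP X A} (π : M.Policy) (p : Measure X) :
    Measure (X × A) :=
  p ⊗ₘ (π.kernel 0).comap (fun x => (Fin.elim0, x)) (by fun_prop)

/-- The conditional law of `(xₙ₊₁, aₙ₊₁)` given `((x₀, a₀), …, (xₙ, aₙ))`: the state `xₙ₊₁` is drawn
from `q(· | xₙ, aₙ)`, then the action `aₙ₊₁` is drawn from the policy. -/
noncomputable def Policy.step {M : MDP X A} (π : M.Policy) (n : ℕ) :
    Kernel (Finset.Iic n → X × A) (X × A) :=
  M.trans.comap (fun h => h ⟨n, Finset.mem_Iic.2 le_rfl⟩) (by fun_prop) ⊗ₖ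
    (π.kernel (n + 1)).comap
      (fun hx : (Finset.Iic n → X × A) × X =>
        ((fun i : Fin (n + 1) => hx.1 ⟨i, Finset.mem_Iic.2 (Nat.le_of_lt_succ i.2)⟩), hx.2))
      (by fun_prop)

instance {M : MDP X A} (π : M.Policy) (p : Measure X) [IsProbabilityMeasure p] :
    IsProbabilityMeasure (π.initial p) := by
  unfold Policy.initial; infer_instance

instance {M : MDP X A} (π : M.Policy) (n : ℕ) : IsMarkovKernel (π.step n) := by
  unfold Policy.step; infer_instance

/-- The law of the state-action process `(xₙ, aₙ)ₙ` on `(X × A)^∞` induced by a policy and an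
initial distribution. -/
noncomputable def Policy.law {M : MDP X A} (π : M.Policy) (p : Measure X)
    [IsProbabilityMeasure p] : Measure (ℕ → X × A) :=
  Kernel.trajMeasure (X := fun _ => X × A) (π.initial p) π.step

/-- The expected `n`-stage cost `E[∑_{k < n} c(xₖ, aₖ)]`. -/
noncomputable def Policy.nStageCost {M : MDP X A} (π : M.Policy) (p : Measure X)
    [IsProbabilityMeasure p] (n : ℕ) : ℝ≥0∞ :=
  ∫⁻ ω, ∑ k ∈ Finset.range n, M.extCost (ω k) ∂(π.law p)

/-- The average cost `J(π, p) = limsup (1 / n) E[∑_{k < n} c(xₖ, aₖ)]`. -/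
noncomputable def Policy.avgCost {M : MDP X A} (π : M.Policy) (p : Measure X)
    [IsProbabilityMeasure p] : ℝ≥0∞ :=
  limsup (fun n : ℕ => π.nStageCost p n / (n : ℝ≥0∞)) atTop

/-- Condition (G): some policy has finite average cost from some initial state. -/
def CondG (M : MDP X A) : Prop :=
  ∃ (π : M.Policy) (x : X), π.avgCost (Measure.dirac x) < ⊤

variable [TopologicalSpace X] [TopologicalSpace A]

/-- Condition (SU) for the sequences `K` and `F`: they are increasing sequences of compact sets
of states and of actions, and the infimum of the cost outside `Kₙ × Fₙ` tends to `+∞`. -/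
def CondSU (M : MDP X A) (K : ℕ → Set X) (F : ℕ → Set A) : Prop :=
  Monotone K ∧ Monotone F ∧ (∀ n, IsCompact (K n)) ∧ (∀ n, IsCompact (F n)) ∧
    Tendsto (fun n => ⨅ z ∈ (K n ×ˢ F n)ᶜ, M.extCost z) atTop (𝓝 ⊤)

/-- Condition (M) for one set `K` of states: the transition probabilities are majorized by a finite
measure on `O \ D`, where `O ⊇ K` is open, and `D` is a closed set such that on `D × A` the
transition kernel is continuous and the cost (`+∞` at inadmissible pairs) is lower
semicontinuous. -/
def CondM [OpensMeasurableSpace X] (M : MDP X A) (K : Set X) : Prop :=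
  ∃ (O D : Set X) (ν : Measure X), IsOpen O ∧ K ⊆ O ∧ IsClosed D ∧ IsFiniteMeasure ν ∧
    (∀ B, MeasurableSet B → ∀ z ∈ M.graph, M.trans z ((O \ D) ∩ B) ≤ ν B) ∧
    ContinuousOn M.transProb (D ×ˢ Set.univ) ∧
    LowerSemicontinuousOn M.extCost (D ×ˢ Set.univ)

end MDP

/-! The proof averages over time. Under a policy with finite average cost, the occupation measures
of the first `n` stages eventually have uniformly bounded expected cost. By (SU) they are tight, and
Prokhorov's theorem gives a weak limit point `Q` on `X × A`.

The kernel and the cost are not regular on all of `X × A`, so weak convergence alone does not carry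
invariance and cost to `Q`. The remedy is `lintegral_le_liminf_of_majorized`: on `D × A` the
integrand is lower semicontinuous; off `D`, up to a small mass outside some `K m`, the state
marginals are majorized by one finite measure `ν + p`, so Lusin's theorem applied to that measure
makes the integrand continuous outside a set uniformly negligible for all occupation measures.

For `f ≥ 0` bounded and continuous, this Fatou inequality applied to `z ↦ ∫ f d(M.trans z)` gives `∫
f d(M.trans ∘ₘ Q) ≤ ∫ f dQ.fst`; replacing `f` by a constant minus `f` turns it into equality, so
`Q` is invariant. Applied to truncated costs, it bounds the cost of `Q` by that of the policy.
Finally `Q` is disintegrated as `Q.fst ⊗ₘ μ`; started from `Q.fst`, the stationary policy `μ` gives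
every pair the law `Q`, and its average cost is `∫ c dQ`. -/

/-! ### Analytic tools: Lusin, portmanteau, Fatou under majorization, equality of measures. -/

section Lusin

/-- **Lusin's theorem**: a measurable function into a second countable space is continuous on a
closed set whose complement has small measure. -/
theorem Measurable.exists_isClosed_continuousOn {X Y : Type*} [TopologicalSpace X]
    [TopologicalSpace.PseudoMetrizableSpace X] [MeasurableSpace X] [BorelSpace X]
    [TopologicalSpace Y] [SecondCountableTopology Y] [MeasurableSpace Y] [OpensMeasurableSpace Y]
    (μ : Measure X) [IsFiniteMeasure μ] {f : X → Y} (hf : Measurable f) {ε : ℝ≥0∞} (hε : ε ≠ 0) :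
    ∃ C, IsClosed C ∧ μ Cᶜ ≤ ε ∧ ContinuousOn f C := by
  obtain ⟨b, hbc, -, hb⟩ := TopologicalSpace.exists_countable_basis Y
  have : Countable b := hbc
  obtain ⟨δ, hδ, hδε⟩ := ENNReal.exists_pos_sum_of_countable' hε b
  have hU (V : b) : ∃ U, f ⁻¹' V ⊆ U ∧ IsOpen U ∧ μ (U \ f ⁻¹' V) < δ V / 2 := by
    obtain ⟨U, h1, h2, -, h3⟩ := (hf (hb.isOpen V.2).measurableSet).exists_isOpen_sdiff_lt
      (measure_ne_top μ _) (ENNReal.half_pos (hδ V).ne').ne'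
    exact ⟨U, h1, h2, h3⟩
  have hF (V : b) : ∃ F, F ⊆ f ⁻¹' V ∧ IsClosed F ∧ μ (f ⁻¹' V \ F) < δ V / 2 :=
    (hf (hb.isOpen V.2).measurableSet).exists_isClosed_sdiff_lt (measure_ne_top μ _)
      (ENNReal.half_pos (hδ V).ne').ne'
  choose U hUsub hUo hUμ using hU
  choose F hFsub hFc hFμ using hF
  -- On this set `F V`, `f ⁻¹' V` and `U V` have the same trace, so preimages of basic open sets are
  -- relatively open.
  refine ⟨(⋃ V, U V \ F V)ᶜ, ?_, ?_, ?_⟩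
  · exact (isOpen_iUnion fun V => (hUo V).sdiff (hFc V)).isClosed_compl
  · rw [compl_compl]
    refine (measure_iUnion_le _).trans ((ENNReal.tsum_le_tsum fun V => ?_).trans hδε.le)
    have hsub : U V \ F V ⊆ (U V \ f ⁻¹' V) ∪ (f ⁻¹' V \ F V) := by
      intro x hx
      by_cases h : x ∈ f ⁻¹' (V : Set Y)
      · exact Or.inr ⟨h, hx.2⟩
      · exact Or.inl ⟨hx.1, h⟩
    calc μ (U V \ F V) ≤ μ (U V \ f ⁻¹' V) + μ (f ⁻¹' V \ F V) :=
          (measure_mono hsub).trans (measure_union_le _ _)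
      _ ≤ δ V / 2 + δ V / 2 := add_le_add (hUμ V).le (hFμ V).le
      _ = δ V := ENNReal.add_halves _
  · intro x hx
    rw [ContinuousWithinAt, hb.nhds_hasBasis.tendsto_right_iff]
    rintro V ⟨hV, hxV⟩
    filter_upwards [self_mem_nhdsWithin,
      mem_nhdsWithin_of_mem_nhds ((hUo ⟨V, hV⟩).mem_nhds (hUsub ⟨V, hV⟩ hxV))] with y hyC hyU
    by_contra hyV
    exact hyC (Set.mem_iUnion.2 ⟨⟨V, hV⟩, hyU, fun h => hyV (hFsub ⟨V, hV⟩ h)⟩)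

end Lusin

section LowerSemicontinuous

/-- A function which is lower semicontinuous on two closed sets remains so on the whole space after
it is replaced by an upper bound outside of the union of these sets. -/
theorem LowerSemicontinuousOn.piecewise_union_const {Z β : Type*} [TopologicalSpace Z]
    [LinearOrder β] {h : Z → β} {C D : Set Z} [DecidablePred (· ∈ C ∪ D)]
    (hC : IsClosed C) (hD : IsClosed D)
    (hhC : LowerSemicontinuousOn h C) (hhD : LowerSemicontinuousOn h D) {b : β}
    (hb : ∀ z, h z ≤ b) :
    LowerSemicontinuous fun z => if z ∈ C ∪ D then h z else b := by
  -- Off the closed set `S` the implication is vacuous near `z`, so it holds eventually at every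
  -- point.
  have key : ∀ S : Set Z, IsClosed S → LowerSemicontinuousOn h S → ∀ z, ∀ y < h z,
      ∀ᶠ z' in 𝓝 z, z' ∈ S → y < h z' := by
    intro S hS hhS z y hy
    by_cases hz : z ∈ S
    · exact eventually_nhdsWithin_iff.1 (hhS z hz y hy)
    · filter_upwards [hS.isOpen_compl.mem_nhds hz] with z' hz' h' using absurd h' hz'
  intro z y hy
  simp only at hy
  have hyb : y < b := by
    split_ifs at hy
    · exact hy.trans_le (hb z)
    · exact hy
  by_cases hz : z ∈ C ∪ D
  · rw [if_pos hz] at hy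
    filter_upwards [key C hC hhC z y hy, key D hD hhD z y hy] with z' h1 h2
    split_ifs with h'
    · exact h'.elim h1 h2
    · exact hyb
  · filter_upwards [(hC.union hD).isOpen_compl.mem_nhds hz] with z' hz'
    rwa [if_neg hz']

/-- Portmanteau theorem for bounded nonnegative lower semicontinuous functions. -/
theorem LowerSemicontinuous.lintegral_le_liminf {Z : Type*} [TopologicalSpace Z]
    [HasOuterApproxClosed Z] [MeasurableSpace Z] [OpensMeasurableSpace Z]
    {P : ℕ → ProbabilityMeasure Z} {Q : ProbabilityMeasure Z} (hP : Tendsto P atTop (𝓝 Q))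
    {h : Z → ℝ≥0∞} (hh : LowerSemicontinuous h) (htop : ∀ z, h z ≠ ⊤) :
    ∫⁻ z, h z ∂(Q : Measure Z) ≤ liminf (fun n => ∫⁻ z, h z ∂(P n : Measure Z)) atTop := by
  have hm : Measurable fun z => (h z).toReal := hh.measurable.ennreal_toReal
  -- The layer-cake formula reduces the claim to superlevel sets, which are open; Fatou in `t` then
  -- concludes.
  have hlayer (μ : Measure Z) :
      ∫⁻ z, h z ∂μ = ∫⁻ t in Set.Ioi (0 : ℝ), μ {z | t < (h z).toReal} := by
    rw [← lintegral_eq_lintegral_meas_lt μ (.of_forall fun _ => ENNReal.toReal_nonneg)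
      hm.aemeasurable]
    simp_rw [ENNReal.ofReal_toReal (htop _)]
  simp_rw [hlayer]
  refine le_trans (setLIntegral_mono' measurableSet_Ioi fun t ht => ?_)
    (lintegral_liminf_le fun n => Antitone.measurable fun s t hst =>
      measure_mono fun z hz => lt_of_le_of_lt hst hz)
  refine ProbabilityMeasure.le_liminf_measure_open_of_tendsto hP ?_
  have : {z | t < (h z).toReal} = h ⁻¹' Set.Ioi (ENNReal.ofReal t) := by
    ext z
    simp [ENNReal.ofReal_lt_iff_lt_toReal (le_of_lt ht) (htop z)]
  rw [this]
  exact hh.isOpen_preimage _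

end LowerSemicontinuous

section Majorization

variable {X A : Type*} [TopologicalSpace X] [TopologicalSpace.PseudoMetrizableSpace X]
  [MeasurableSpace X] [BorelSpace X] [TopologicalSpace A] [DiscreteTopology A]
  [Countable A] [MeasurableSpace A] [BorelSpace A]

/-- Let `P n → Q` weakly on `X × A` with `A` countable and discrete. A bounded measurable function
`h ≥ 0` satisfies the Fatou type inequality of lower semicontinuous functions as soon as, up to any
`ε > 0`, it is lower semicontinuous on some closed cylinder `D × A` outside of which the first
marginals of the `P n` are majorized by one finite measure. -/
theorem lintegral_le_liminf_of_majorized {P : ℕ → ProbabilityMeasure (X × A)}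
    {Q : ProbabilityMeasure (X × A)} (hP : Tendsto P atTop (𝓝 Q))
    {h : X × A → ℝ≥0∞} (hm : Measurable h) {b : ℝ≥0∞} (hb : b ≠ ⊤) (hhb : ∀ z, h z ≤ b)
    (hmaj : ∀ ε : ℝ≥0∞, ε ≠ 0 → ∃ (D : Set X) (ν : Measure X), IsFiniteMeasure ν ∧ IsClosed D ∧
      LowerSemicontinuousOn h (D ×ˢ Set.univ) ∧
      ∀ n B, MeasurableSet B → (P n : Measure (X × A)).fst (Dᶜ ∩ B) ≤ ν B + ε) :
    ∫⁻ z, h z ∂(Q : Measure (X × A)) ≤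
      liminf (fun n => ∫⁻ z, h z ∂(P n : Measure (X × A))) atTop := by
  classical
  have approx : ∀ ε : ℝ≥0∞, ε ≠ 0 → ∫⁻ z, h z ∂(Q : Measure (X × A)) ≤
      liminf (fun n => ∫⁻ z, h z ∂(P n : Measure (X × A))) atTop + b * (ε + ε) := by
    intro ε hε
    obtain ⟨D, ν, hν, hD, hlsc, hle⟩ := hmaj ε hε
    -- As a map into the countable power of `ℝ≥0∞` indexed by `A`, `h` admits one Lusin set `C`
    -- serving all actions at once.
    have hcurry : Measurable fun (x : X) (a : A) => h (x, a) :=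
      measurable_pi_lambda _ fun a => hm.comp measurable_prodMk_right
    obtain ⟨C, hC, hνC, hcont⟩ := hcurry.exists_isClosed_continuousOn ν hε
    have hlscC : LowerSemicontinuousOn h (C ×ˢ Set.univ) := by
      refine ContinuousOn.lowerSemicontinuousOn ?_
      refine continuousOn_prod_of_discrete_right.2 fun a => ?_
      have hset : {x | (x, a) ∈ C ×ˢ (Set.univ : Set A)} = C := by ext; simp
      rw [hset]
      exact (continuous_apply a).comp_continuousOn hcont
    set S : Set (X × A) := C ×ˢ Set.univ ∪ D ×ˢ Set.univ with hS
    have hlsc' : LowerSemicontinuous fun z => if z ∈ S then h z else b :=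
      hlscC.piecewise_union_const (hC.prod isClosed_univ) (hD.prod isClosed_univ) hlsc hhb
    have hSm : MeasurableSet S :=
      (hC.measurableSet.prod .univ).union (hD.measurableSet.prod .univ)
    have hPS (n : ℕ) : (P n : Measure (X × A)) Sᶜ ≤ ε + ε := by
      have hpre : Sᶜ = Prod.fst ⁻¹' (Dᶜ ∩ Cᶜ) := by
        ext z; simp [hS, and_comm]
      rw [hpre, ← Measure.fst_apply (hD.measurableSet.compl.inter hC.measurableSet.compl)]
      exact (hle n _ hC.measurableSet.compl).trans (by gcongr)
    -- Raising `h` to `b` off `S` only increases the left side, so no bound on `Q Sᶜ` is needed; the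
    -- cost on the right is `b * P n Sᶜ`.
    calc ∫⁻ z, h z ∂(Q : Measure (X × A))
        ≤ ∫⁻ z, (if z ∈ S then h z else b) ∂(Q : Measure (X × A)) := by
          refine lintegral_mono fun z => ?_
          simp only
          split_ifs
          · exact le_rfl
          · exact hhb z
      _ ≤ liminf (fun n => ∫⁻ z, (if z ∈ S then h z else b) ∂(P n : Measure (X × A))) atTop :=
          hlsc'.lintegral_le_liminf hP fun z => by
            split_ifs
            · exact ne_top_of_le_ne_top hb (hhb z)
            · exact hb
      _ ≤ liminf (fun n => ∫⁻ z, h z ∂(P n : Measure (X × A)) + b * (ε + ε)) atTop := by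
          refine liminf_le_liminf (.of_forall fun n => ?_)
          calc ∫⁻ z, (if z ∈ S then h z else b) ∂(P n : Measure (X × A))
              ≤ ∫⁻ z, h z + Sᶜ.indicator (fun _ => b) z ∂(P n : Measure (X × A)) := by
                refine lintegral_mono fun z => ?_
                by_cases hz : z ∈ S <;> simp [hz]
            _ = ∫⁻ z, h z ∂(P n : Measure (X × A)) + b * (P n : Measure (X × A)) Sᶜ := by
                rw [lintegral_add_left hm, lintegral_indicator_const hSm.compl]
            _ ≤ _ := by gcongr; exact hPS n
      _ = _ := by
          refine (liminf_add_const atTop _ _ ?_ ?_) <;> isBoundedDefault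
  have hlim : Tendsto (fun ε : ℝ≥0∞ =>
      liminf (fun n => ∫⁻ z, h z ∂(P n : Measure (X × A))) atTop + b * (ε + ε)) (𝓝[≠] 0)
      (𝓝 (liminf (fun n => ∫⁻ z, h z ∂(P n : Measure (X × A))) atTop + b * (0 + 0))) := by
    refine Tendsto.mono_left ?_ nhdsWithin_le_nhds
    exact tendsto_const_nhds.add
      (ENNReal.Tendsto.const_mul (tendsto_id.add tendsto_id) (Or.inr hb))
  simp only [add_zero, mul_zero] at hlim
  exact ge_of_tendsto hlim (eventually_nhdsWithin_of_forall fun ε hε => approx ε hε)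

end Majorization

section Ext

open BoundedContinuousFunction NNReal

/-- Two probability measures agree if the integrals of nonnegative bounded continuous functions with
respect to one are at most those with respect to the other. -/
theorem MeasureTheory.Measure.ext_of_forall_lintegral_le {X : Type*} [TopologicalSpace X]
    [HasOuterApproxClosed X] [MeasurableSpace X] [BorelSpace X] {μ ν : Measure X}
    [IsProbabilityMeasure μ] [IsProbabilityMeasure ν]
    (h : ∀ f : X →ᵇ ℝ≥0, ∫⁻ x, f x ∂μ ≤ ∫⁻ x, f x ∂ν) : μ = ν := by
  refine ext_of_forall_lintegral_eq_of_IsFiniteMeasure fun f => (h f).antisymm ?_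
  have hf (x : X) : f x ≤ nndist f 0 := BoundedContinuousFunction.NNReal.upper_bound f x
  -- Since `f` is below its norm, the truncated subtraction is exact, and the hypothesis for `g` is
  -- the reverse inequality for `f`.
  let g : X →ᵇ ℝ≥0 := BoundedContinuousFunction.const X (nndist f 0) - f
  have hsum (ρ : Measure X) [IsProbabilityMeasure ρ] :
      ∫⁻ x, f x ∂ρ + ∫⁻ x, g x ∂ρ = nndist f 0 := by
    rw [← lintegral_add_left (by fun_prop)]
    have : ∀ x, (f x : ℝ≥0∞) + g x = nndist f 0 := fun x => by
      rw [← ENNReal.coe_add]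
      exact congrArg _ (add_tsub_cancel_of_le (hf x))
    simp [this]
  have hfin (ρ : Measure X) [IsProbabilityMeasure ρ] : ∫⁻ x, g x ∂ρ ≠ ⊤ :=
    ne_top_of_le_ne_top ENNReal.coe_ne_top (le_add_self.trans (hsum ρ).le)
  refine (ENNReal.add_le_add_iff_right (hfin ν)).1 ?_
  rw [hsum ν, ← hsum μ]
  exact add_le_add_right (h g) _

end Ext

/-! ### Laws of state-action pairs and stationary policies. -/

namespace MDP

variable {X : Type u} {A : Type v} [MeasurableSpace X] [MeasurableSpace A] {M : MDP X A}

theorem measurable_extCost (M : MDP X A) : Measurable M.extCost := by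
  classical
  exact Measurable.dite (s := {z : X × A | z.2 ∈ M.admissible z.1}) M.measurable_cost
    measurable_const M.measurableSet_graph

theorem extCost_of_notMem_graph {z : X × A} (hz : z ∉ M.graph) : M.extCost z = ⊤ :=
  dif_neg hz

instance (π : M.Policy) (p : Measure X) [IsProbabilityMeasure p] :
    IsProbabilityMeasure (π.law p) := by
  unfold Policy.law; infer_instance

/-- The law of the state-action pair `(xₙ, aₙ)`. -/
noncomputable def Policy.pairLaw (π : M.Policy) (p : Measure X) [IsProbabilityMeasure p]
    (n : ℕ) : Measure (X × A) :=
  (π.law p).map fun ω => ω n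

instance (π : M.Policy) (p : Measure X) [IsProbabilityMeasure p] (n : ℕ) :
    IsProbabilityMeasure (π.pairLaw p n) :=
  Measure.isProbabilityMeasure_map (measurable_pi_apply n).aemeasurable

theorem Policy.pairLaw_zero (π : M.Policy) (p : Measure X) [IsProbabilityMeasure p] :
    π.pairLaw p 0 = π.initial p := by
  let e : (Finset.Iic 0 → X × A) ≃ᵐ X × A := MeasurableEquiv.piUnique fun _ => X × A
  let r : (ℕ → X × A) → Finset.Iic 0 → X × A := Preorder.frestrictLe (π := fun _ => X × A) 0
  have hr : Measurable r := Preorder.measurable_frestrictLe 0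
  have hlaw : (π.law p).map r = (π.initial p).map e.symm := by
    refine (Measure.map_comp _ _ hr).trans ?_
    rw [Kernel.traj_map_frestrictLe, Kernel.partialTraj_self, Measure.id_comp]
  calc π.pairLaw p 0 = ((π.law p).map r).map e := (Measure.map_map e.measurable hr).symm
    _ = π.initial p := by rw [hlaw, MeasurableEquiv.map_map_symm]

theorem Policy.pairLaw_succ (π : M.Policy) (p : Measure X) [IsProbabilityMeasure p] (n : ℕ) :
    π.pairLaw p (n + 1) =
      π.step n ∘ₘ (π.law p).map (Preorder.frestrictLe (π := fun _ => X × A) n) := by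
  rw [← Measure.snd_compProd, Policy.law,
    Kernel.map_frestrictLe_trajMeasure_compProd_eq_map_trajMeasure, Measure.snd,
    Measure.map_map measurable_snd (by fun_prop)]
  rfl

theorem Policy.fst_pairLaw_zero (π : M.Policy) (p : Measure X) [IsProbabilityMeasure p] :
    (π.pairLaw p 0).fst = p := by
  rw [π.pairLaw_zero, Policy.initial, Measure.fst_compProd]

/-- The state `xₙ₊₁` has the law obtained by applying the transition kernel to the law of
`(xₙ, aₙ)`. -/
theorem Policy.fst_pairLaw_succ (π : M.Policy) (p : Measure X) [IsProbabilityMeasure p] (n : ℕ) :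
    (π.pairLaw p (n + 1)).fst = M.trans ∘ₘ π.pairLaw p n := by
  rw [π.pairLaw_succ, Measure.fst, Measure.map_comp _ _ measurable_fst, ← Kernel.fst_eq,
    Policy.step, Kernel.fst_compProd]
  ext s hs
  rw [Measure.bind_apply hs (Kernel.aemeasurable _), Measure.bind_apply hs (Kernel.aemeasurable _),
    Policy.pairLaw, lintegral_map (Kernel.measurable_coe _ hs) (measurable_pi_apply n),
    lintegral_map (Kernel.measurable_coe _ hs) (Preorder.measurable_frestrictLe n)]
  rfl

/-- Under a stationary policy the action is drawn from its kernel at the current state. -/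
theorem StationaryPolicy.pairLaw_eq (μ : M.StationaryPolicy) (p : Measure X)
    [IsProbabilityMeasure p] (n : ℕ) :
    μ.toPolicy.pairLaw p n = (μ.toPolicy.pairLaw p n).fst ⊗ₘ μ.kernel := by
  cases n with
  | zero =>
    rw [Policy.fst_pairLaw_zero, Policy.pairLaw_zero]
    rfl
  | succ n =>
    ext s hs
    rw [Measure.compProd_apply hs, Policy.fst_pairLaw_succ,
      Measure.lintegral_bind (Kernel.aemeasurable _)
        (Kernel.measurable_kernel_prodMk_left hs).aemeasurable,
      Policy.pairLaw_succ, Measure.bind_apply hs (Kernel.aemeasurable _),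
      lintegral_map (Kernel.measurable_coe _ hs) (Preorder.measurable_frestrictLe n),
      Policy.pairLaw, lintegral_map
        (Measurable.lintegral_kernel (Kernel.measurable_kernel_prodMk_left hs))
        (measurable_pi_apply n)]
    refine lintegral_congr fun ω => ?_
    rw [Policy.step, Kernel.compProd_apply hs]
    rfl

/-- Translates invariance of a state-action measure into invariance for the induced chain on states.
-/
theorem StationaryPolicy.chain_comp (μ : M.StationaryPolicy) (p : Measure X)
    [IsProbabilityMeasure p] : μ.chain ∘ₘ p = M.trans ∘ₘ (p ⊗ₘ μ.kernel) := by
  ext s hs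
  rw [Measure.bind_apply hs (Kernel.aemeasurable _), Measure.bind_apply hs (Kernel.aemeasurable _),
    Measure.lintegral_compProd (Kernel.measurable_coe _ hs)]
  refine lintegral_congr fun x => ?_
  rw [StationaryPolicy.chain, Kernel.snd_apply' _ _ hs, Kernel.compProd_apply (measurable_snd hs)]
  rfl

/-- Started from an invariant distribution, the state-action pairs of a stationary policy are
identically distributed. -/
theorem StationaryPolicy.pairLaw_of_invariant (μ : M.StationaryPolicy) (p : Measure X)
    [IsProbabilityMeasure p] (h : μ.chain.Invariant p) (n : ℕ) :
    μ.toPolicy.pairLaw p n = p ⊗ₘ μ.kernel := by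
  induction n with
  | zero => rw [μ.pairLaw_eq, Policy.fst_pairLaw_zero]
  | succ n ih => rw [μ.pairLaw_eq, Policy.fst_pairLaw_succ, ih, ← μ.chain_comp, h.def]

theorem Policy.nStageCost_eq (π : M.Policy) (p : Measure X) [IsProbabilityMeasure p] (n : ℕ) :
    π.nStageCost p n = ∑ k ∈ Finset.range n, ∫⁻ z, M.extCost z ∂π.pairLaw p k := by
  have hm (k : ℕ) : Measurable fun ω : ℕ → X × A => M.extCost (ω k) :=
    M.measurable_extCost.comp (measurable_pi_apply k)
  rw [Policy.nStageCost, lintegral_finsetSum _ fun k _ => hm k]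
  refine Finset.sum_congr rfl fun k _ => ?_
  rw [Policy.pairLaw, lintegral_map M.measurable_extCost (measurable_pi_apply k)]

/-- The average cost of a stationary policy started from an invariant distribution. -/
theorem StationaryPolicy.avgCost_of_invariant (μ : M.StationaryPolicy) (p : Measure X)
    [IsProbabilityMeasure p] (h : μ.chain.Invariant p) :
    μ.toPolicy.avgCost p = ∫⁻ z, M.extCost z ∂(p ⊗ₘ μ.kernel) := by
  refine Tendsto.limsup_eq (tendsto_const_nhds.congr' ?_)
  -- The averages are constant except at `n = 0`, where the quotient is `0 / 0`.
  filter_upwards [eventually_ne_atTop 0] with n hn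
  simp_rw [Policy.nStageCost_eq, μ.pairLaw_of_invariant p h]
  rw [Finset.sum_const, Finset.card_range, nsmul_eq_mul, mul_comm,
    ENNReal.mul_div_cancel_right (by simpa using hn) (ENNReal.natCast_ne_top n)]

end MDP

/-- An average is at most an upper bound of its terms. -/
theorem ENNReal.inv_mul_sum_range_le {n : ℕ} {f : ℕ → ℝ≥0∞} {b : ℝ≥0∞} (h : ∀ k, f k ≤ b) :
    (n : ℝ≥0∞)⁻¹ * ∑ k ∈ Finset.range n, f k ≤ b := by
  calc (n : ℝ≥0∞)⁻¹ * ∑ k ∈ Finset.range n, f k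
      ≤ (n : ℝ≥0∞)⁻¹ * (n * b) := by
        gcongr
        simpa using Finset.sum_le_card_nsmul (Finset.range n) f b fun k _ => h k
    _ = ((n : ℝ≥0∞)⁻¹ * n) * b := (mul_assoc _ _ _).symm
    _ ≤ 1 * b := by gcongr; exact ENNReal.inv_mul_le_one _
    _ = b := one_mul b

/-! ### Occupation measures: cost, majorization, approximate invariance. -/

namespace MDP

section Occupation

variable {X : Type u} {A : Type v} [MeasurableSpace X] [MeasurableSpace A] {M : MDP X A}

/-- The cost is `⊤` off the graph. This gives access to the majorization in (M), assumed only on the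
graph, and to the disintegration of the limit. -/
theorem measure_compl_graph_of_lintegral_extCost_ne_top {ρ : Measure (X × A)}
    (h : ∫⁻ z, M.extCost z ∂ρ ≠ ⊤) : ρ M.graphᶜ = 0 := by
  refine measure_mono_null (fun z hz => ?_) (ae_lt_top M.measurable_extCost h)
  simp [extCost_of_notMem_graph hz]

/-- One infinite stage cost would make all later averages infinite. -/
theorem Policy.lintegral_extCost_pairLaw_ne_top (π : M.Policy) (p : Measure X)
    [IsProbabilityMeasure p] (hJ : π.avgCost p < ⊤) (k : ℕ) :
    ∫⁻ z, M.extCost z ∂π.pairLaw p k ≠ ⊤ := by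
  obtain ⟨n, hn, hkn⟩ :=
    ((eventually_lt_of_limsup_lt hJ).and (eventually_gt_atTop k)).exists
  intro htop
  rw [π.nStageCost_eq, ENNReal.sum_eq_top.2 ⟨k, Finset.mem_range.2 hkn, htop⟩,
    ENNReal.top_div_of_ne_top (ENNReal.natCast_ne_top n)] at hn
  exact lt_irrefl _ hn

/-- The expected occupation measure `n⁻¹ ∑_{k < n} law (xₖ, aₖ)` of the first `n` stages. -/
noncomputable def Policy.occupation (π : M.Policy) (p : Measure X) [IsProbabilityMeasure p]
    (n : ℕ) : Measure (X × A) :=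
  (n : ℝ≥0∞)⁻¹ • ∑ k ∈ Finset.range n, π.pairLaw p k

theorem Policy.lintegral_occupation (π : M.Policy) (p : Measure X) [IsProbabilityMeasure p]
    (n : ℕ) (f : X × A → ℝ≥0∞) :
    ∫⁻ z, f z ∂π.occupation p n =
      (n : ℝ≥0∞)⁻¹ * ∑ k ∈ Finset.range n, ∫⁻ z, f z ∂π.pairLaw p k := by
  rw [Policy.occupation, lintegral_smul_measure, lintegral_finsetSum_measure, smul_eq_mul]

theorem Policy.lintegral_extCost_occupation (π : M.Policy) (p : Measure X)
    [IsProbabilityMeasure p] (n : ℕ) :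
    ∫⁻ z, M.extCost z ∂π.occupation p n = π.nStageCost p n / n := by
  rw [π.lintegral_occupation, π.nStageCost_eq, ENNReal.div_eq_inv_mul]

theorem Policy.isProbabilityMeasure_occupation (π : M.Policy) (p : Measure X)
    [IsProbabilityMeasure p] {n : ℕ} (hn : n ≠ 0) :
    IsProbabilityMeasure (π.occupation p n) := by
  constructor
  rw [← lintegral_one, π.lintegral_occupation]
  simpa using ENNReal.inv_mul_cancel (by simpa using hn) (ENNReal.natCast_ne_top n)

theorem Policy.occupation_apply_le (π : M.Policy) (p : Measure X) [IsProbabilityMeasure p]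
    (n : ℕ) {s : Set (X × A)} (hs : MeasurableSet s) {b : ℝ≥0∞}
    (h : ∀ k, π.pairLaw p k s ≤ b) : π.occupation p n s ≤ b := by
  rw [← lintegral_indicator_one hs, π.lintegral_occupation]
  refine ENNReal.inv_mul_sum_range_le fun k => ?_
  rw [lintegral_indicator_one hs]
  exact h k

/-- A majorization of the transition probabilities passes on to the occupation measures. -/
theorem Policy.fst_occupation_inter_le (π : M.Policy) (p : Measure X) [IsProbabilityMeasure p]
    (hπ : ∀ k, π.pairLaw p k M.graphᶜ = 0) {S : Set X} (hS : MeasurableSet S) {ν : Measure X}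
    (hν : ∀ B, MeasurableSet B → ∀ z ∈ M.graph, M.trans z (S ∩ B) ≤ ν B)
    (n : ℕ) {B : Set X} (hB : MeasurableSet B) :
    (π.occupation p n).fst (S ∩ B) ≤ (ν + p) B := by
  rw [Measure.fst_apply (hS.inter hB)]
  refine π.occupation_apply_le p n (measurable_fst (hS.inter hB)) fun k => ?_
  rw [← Measure.fst_apply (hS.inter hB), Measure.add_apply]
  cases k with
  | zero =>
    -- The initial state is not produced by a transition; its law is the reason for the summand `p`.
    rw [π.fst_pairLaw_zero]
    exact (measure_mono Set.inter_subset_right).trans le_add_self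
  | succ k =>
    rw [π.fst_pairLaw_succ, Measure.bind_apply (hS.inter hB) (Kernel.aemeasurable _)]
    have hae : ∀ᵐ z ∂π.pairLaw p k, M.trans z (S ∩ B) ≤ ν B := by
      have hg : ∀ᵐ z ∂π.pairLaw p k, z ∈ M.graph := hπ k
      filter_upwards [hg] with z hz using hν B hB z hz
    calc ∫⁻ z, M.trans z (S ∩ B) ∂π.pairLaw p k ≤ ∫⁻ _, ν B ∂π.pairLaw p k := lintegral_mono_ae hae
      _ = ν B := by simp
      _ ≤ ν B + p B := le_self_add

/-- Up to a boundary term, the occupation measures are invariant. -/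
theorem Policy.lintegral_trans_occupation_le (π : M.Policy) (p : Measure X)
    [IsProbabilityMeasure p] (n : ℕ) {f : X → ℝ≥0∞} (hf : Measurable f) {b : ℝ≥0∞}
    (hb : ∀ x, f x ≤ b) :
    ∫⁻ z, ∫⁻ x, f x ∂M.trans z ∂π.occupation p n ≤
      ∫⁻ z, f z.1 ∂π.occupation p n + (n : ℝ≥0∞)⁻¹ * b := by
  have hnext (k : ℕ) : ∫⁻ z, ∫⁻ x, f x ∂M.trans z ∂π.pairLaw p k =
      ∫⁻ z, f z.1 ∂π.pairLaw p (k + 1) := by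
    rw [← Measure.lintegral_bind (Kernel.aemeasurable _) hf.aemeasurable, ← π.fst_pairLaw_succ,
      Measure.fst, lintegral_map hf measurable_fst]
  simp_rw [π.lintegral_occupation, hnext]
  rw [← mul_add]
  gcongr
  -- The shifted sum exceeds the original by at most its last term, which is at most `b`.
  calc ∑ k ∈ Finset.range n, ∫⁻ z, f z.1 ∂π.pairLaw p (k + 1)
      ≤ ∑ k ∈ Finset.range (n + 1), ∫⁻ z, f z.1 ∂π.pairLaw p k := by
        rw [Finset.sum_range_succ']
        exact le_self_add
    _ = ∑ k ∈ Finset.range n, ∫⁻ z, f z.1 ∂π.pairLaw p k + ∫⁻ z, f z.1 ∂π.pairLaw p n :=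
        Finset.sum_range_succ _ _
    _ ≤ _ := by
        gcongr
        calc ∫⁻ z, f z.1 ∂π.pairLaw p n ≤ ∫⁻ _, b ∂π.pairLaw p n :=
              lintegral_mono fun z => hb z.1
          _ = b := by simp

end Occupation

/-! ### Disintegration into a stationary policy. -/

section Disintegration

variable {X : Type u} {A : Type v} [MeasurableSpace X] [MeasurableSpace A] [Countable A]

/-- Take the first admissible action in an enumeration of `A`. -/
theorem exists_measurable_selector (M : MDP X A) :
    ∃ s : X → A, Measurable s ∧ ∀ x, s x ∈ M.admissible x := by
  classical
  rcases isEmpty_or_nonempty X with hX | ⟨⟨x₀⟩⟩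
  · exact ⟨isEmptyElim, measurable_of_empty _, isEmptyElim⟩
  have : Nonempty A := (M.admissible_nonempty x₀).to_type
  obtain ⟨e, he⟩ := exists_surjective_nat A
  have hex (x : X) : ∃ n, e n ∈ M.admissible x := by
    obtain ⟨a, ha⟩ := M.admissible_nonempty x
    obtain ⟨n, rfl⟩ := he a
    exact ⟨n, ha⟩
  refine ⟨fun x => e (Nat.find (hex x)), ?_, fun x => Nat.find_spec (hex x)⟩
  refine (measurable_from_nat (f := e)).comp (measurable_find hex fun n => ?_)
  exact measurable_prodMk_right M.measurableSet_graph

/-- A probability measure on state-action pairs which is carried by the graph of the control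
constraint disintegrates along a stationary policy. -/
theorem exists_stationaryPolicy_compProd_eq [DiscreteMeasurableSpace A] (M : MDP X A)
    (ρ : Measure (X × A)) [IsProbabilityMeasure ρ] (hρ : ρ M.graphᶜ = 0) :
    ∃ μ : M.StationaryPolicy, ρ.fst ⊗ₘ μ.kernel = ρ := by
  classical
  have : Nonempty A := (nonempty_of_isProbabilityMeasure ρ).map Prod.snd
  obtain ⟨s, hs, hsadm⟩ := M.exists_measurable_selector
  have hadm (x : X) : MeasurableSet (M.admissible x) := .of_discrete
  have hgood : MeasurableSet {x | ρ.condKernel x (M.admissible x) = 1} :=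
    (Kernel.measurable_kernel_prodMk_left (κ := ρ.condKernel) M.measurableSet_graph)
      (measurableSet_singleton 1)
  -- The conditional kernel is admissible only almost surely; a selector repairs it on the
  -- exceptional null set, since a policy must be admissible at every state.
  let κ : Kernel X A := Kernel.piecewise hgood ρ.condKernel (Kernel.deterministic s hs)
  refine ⟨⟨κ, inferInstance, fun x => ?_⟩, ?_⟩
  · rw [Kernel.piecewise_apply]
    split_ifs with hx
    · exact hx
    · rw [Kernel.deterministic_apply' _ _ (hadm x)]
      simp [hsadm x]
  · have hae : ∀ᵐ x ∂ρ.fst, ρ.condKernel x (M.admissible x) = 1 := by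
      have h1 : ∀ᵐ z ∂(ρ.fst ⊗ₘ ρ.condKernel), z ∈ M.graph := by
        rw [ρ.disintegrate]
        exact hρ
      filter_upwards [Measure.ae_ae_of_ae_compProd h1] with x hx
      exact prob_compl_eq_zero_iff (hadm x) |>.1 hx
    calc ρ.fst ⊗ₘ κ = ρ.fst ⊗ₘ ρ.condKernel := by
          refine Measure.compProd_congr ?_
          filter_upwards [hae] with x hx
          exact (Kernel.piecewise_apply ..).trans (if_pos hx)
      _ = ρ := ρ.disintegrate _

end Disintegration

end MDP

/-! ### Tightness and passage to the limit. -/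

namespace MDP

section Limit

variable {X : Type u} {A : Type v} [MeasurableSpace X] [MeasurableSpace A]
  [TopologicalSpace X] [TopologicalSpace A] {M : MDP X A} {K : ℕ → Set X} {F : ℕ → Set A}

/-- Under (SU), measures with a common bound on their expected costs are uniformly tight. -/
theorem CondSU.exists_measure_compl_le (hSU : M.CondSU K F) {L : ℝ≥0∞} (hL : L ≠ ⊤)
    {ε : ℝ≥0∞} (hε : ε ≠ 0) :
    ∃ m, ∀ ρ : Measure (X × A), ∫⁻ z, M.extCost z ∂ρ ≤ L → ρ (K m ×ˢ F m)ᶜ ≤ ε := by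
  rcases eq_or_ne ε ⊤ with rfl | hεtop
  · exact ⟨0, fun _ _ => le_top⟩
  -- Level for Markov's inequality; the `1` keeps it nonzero when `L = 0`.
  have hc : L / ε + 1 < ⊤ := ENNReal.add_lt_top.2 ⟨ENNReal.div_lt_top hL hε, ENNReal.one_lt_top⟩
  obtain ⟨m, hm⟩ := (hSU.2.2.2.2.eventually (lt_mem_nhds hc)).exists
  refine ⟨m, fun ρ hρ => ?_⟩
  calc ρ (K m ×ˢ F m)ᶜ ≤ ρ {z | L / ε + 1 ≤ M.extCost z} :=
        measure_mono fun z hz => hm.le.trans (iInf₂_le z hz)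
    _ ≤ (∫⁻ z, M.extCost z ∂ρ) / (L / ε + 1) :=
        meas_ge_le_lintegral_div M.measurable_extCost.aemeasurable (by simp) hc.ne
    _ ≤ L / (L / ε + 1) := by gcongr
    _ ≤ ε := by
        refine ENNReal.div_le_of_le_mul ?_
        rw [mul_add, ENNReal.mul_div_cancel hε hεtop]
        exact le_self_add

open BoundedContinuousFunction NNReal in
/-- Integrals of bounded continuous functions depend continuously on the state-action pair wherever
the transition kernel does. -/
theorem continuousOn_lintegral_trans [OpensMeasurableSpace X] {S : Set (X × A)}
    (h : ContinuousOn M.transProb S) (f : X →ᵇ ℝ≥0) :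
    ContinuousOn (fun z => ∫⁻ x, f x ∂M.trans z) S := fun z hz =>
  (ProbabilityMeasure.tendsto_iff_forall_lintegral_tendsto.1 (h z hz)) f

variable [TopologicalSpace.MetrizableSpace X] [BorelSpace X]
  [DiscreteTopology A] [Countable A] [BorelSpace A]

/-- The occupation measures of a policy with finite average cost have a weak limit point. -/
theorem Policy.exists_tendsto_occupation [SecondCountableTopology X] (hSU : M.CondSU K F)
    (π : M.Policy) (p : Measure X) [IsProbabilityMeasure p] (hJ : π.avgCost p < ⊤) :
    ∃ (N : ℕ → ℕ) (P : ℕ → ProbabilityMeasure (X × A)) (Q : ProbabilityMeasure (X × A))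
      (L : ℝ≥0∞), L ≠ ⊤ ∧ Tendsto N atTop atTop ∧ Tendsto P atTop (𝓝 Q) ∧
      (∀ n, (P n : Measure (X × A)) = π.occupation p (N n)) ∧
      ∀ n, ∫⁻ z, M.extCost z ∂(P n : Measure (X × A)) ≤ L := by
  obtain ⟨L, hJL, hL⟩ := exists_between hJ
  obtain ⟨n₀, hn₀⟩ := eventually_atTop.1 (eventually_lt_of_limsup_lt hJL)
  -- The shift by `n₀` ensures the cost bound `L`; the extra `1` excludes the zero measure at `n =
  -- 0`.
  let P (n : ℕ) : ProbabilityMeasure (X × A) :=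
    ⟨π.occupation p (n + n₀ + 1), π.isProbabilityMeasure_occupation p (Nat.succ_ne_zero _)⟩
  have hPL (n : ℕ) : ∫⁻ z, M.extCost z ∂(P n : Measure (X × A)) ≤ L := by
    change ∫⁻ z, M.extCost z ∂π.occupation p (n + n₀ + 1) ≤ L
    rw [π.lintegral_extCost_occupation]
    exact (hn₀ _ (by omega)).le
  have htight : IsTightMeasureSet {((μ : ProbabilityMeasure (X × A)) : Measure (X × A)) |
      μ ∈ Set.range P} := by
    refine isTightMeasureSet_iff_exists_isCompact_measure_compl_le.2 fun ε hε => ?_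
    obtain ⟨m, hm⟩ := hSU.exists_measure_compl_le hL.ne hε.ne'
    refine ⟨K m ×ˢ F m, (hSU.2.2.1 m).prod (hSU.2.2.2.1 m), ?_⟩
    rintro _ ⟨_, ⟨n, rfl⟩, rfl⟩
    exact hm _ (hPL n)
  obtain ⟨Q, -, φ, hφ, hlim⟩ := (isCompact_closure_of_isTightMeasureSet htight).tendsto_subseq
    fun n => subset_closure (Set.mem_range_self n)
  refine ⟨fun n => φ n + n₀ + 1, P ∘ φ, Q, L, hL.ne, ?_, hlim, fun n => rfl, fun n => hPL _⟩
  exact tendsto_atTop_mono (fun n => (hφ.le_apply (x := n)).trans (by omega)) tendsto_id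

/-- Under (SU) and (M), Fatou's inequality holds along weakly convergent occupation measures for
bounded functions which are lower semicontinuous wherever the model is. -/
theorem Policy.lintegral_le_liminf_occupation (hSU : M.CondSU K F) (hM : ∀ n, M.CondM (K n))
    (π : M.Policy) (p : Measure X) [IsProbabilityMeasure p]
    (hπ : ∀ k, π.pairLaw p k M.graphᶜ = 0)
    {N : ℕ → ℕ} {P : ℕ → ProbabilityMeasure (X × A)} {Q : ProbabilityMeasure (X × A)}
    (hP : Tendsto P atTop (𝓝 Q)) (hPN : ∀ n, (P n : Measure (X × A)) = π.occupation p (N n))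
    {L : ℝ≥0∞} (hL : L ≠ ⊤) (hPL : ∀ n, ∫⁻ z, M.extCost z ∂(P n : Measure (X × A)) ≤ L)
    {h : X × A → ℝ≥0∞} (hm : Measurable h) {b : ℝ≥0∞} (hb : b ≠ ⊤) (hhb : ∀ z, h z ≤ b)
    (hlsc : ∀ D : Set X, ContinuousOn M.transProb (D ×ˢ Set.univ) →
      LowerSemicontinuousOn M.extCost (D ×ˢ Set.univ) →
      LowerSemicontinuousOn h (D ×ˢ Set.univ)) :
    ∫⁻ z, h z ∂(Q : Measure (X × A)) ≤
      liminf (fun n => ∫⁻ z, h z ∂(P n : Measure (X × A))) atTop := by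
  refine lintegral_le_liminf_of_majorized hP hm hb hhb fun ε hε => ?_
  obtain ⟨m, hm⟩ := hSU.exists_measure_compl_le hL hε
  obtain ⟨O, D, ν, hO, hKO, hD, hν, hle, hcont, hcost⟩ := hM m
  refine ⟨D, ν + p, inferInstance, hD, hlsc D hcont hcost, fun n B hB => ?_⟩
  have hS : MeasurableSet (O \ D) := (hO.sdiff hD).measurableSet
  have hKc : MeasurableSet (K m)ᶜ := (hSU.2.2.1 m).measurableSet.compl
  -- The first piece is majorized by `ν + p`, the second has mass at most `ε` by tightness.
  have hsub : Dᶜ ∩ B ⊆ (O \ D) ∩ B ∪ (K m)ᶜ := by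
    rintro x ⟨hxD, hxB⟩
    by_cases hx : x ∈ K m
    · exact Or.inl ⟨⟨hKO hx, hxD⟩, hxB⟩
    · exact Or.inr hx
  refine (measure_mono hsub).trans ((measure_union_le _ _).trans (add_le_add ?_ ?_))
  · rw [hPN]
    exact π.fst_occupation_inter_le p hπ hS hle (N n) hB
  · rw [Measure.fst_apply hKc]
    refine (measure_mono fun z hz => ?_).trans (hm _ (hPL n))
    exact fun hz' => hz hz'.1

/-- Under (SU) and (M), the occupation measures of a policy with finite average cost have a limit
point which is invariant and whose expected cost is at most the average cost of the policy. -/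
theorem Policy.exists_invariant_occupation [SecondCountableTopology X]
    (hSU : M.CondSU K F) (hM : ∀ n, M.CondM (K n)) (π : M.Policy) (p : Measure X) [IsProbabilityMeasure p] (hJ : π.avgCost p < ⊤) :
    ∃ Q : ProbabilityMeasure (X × A),
      M.trans ∘ₘ (Q : Measure (X × A)) = (Q : Measure (X × A)).fst ∧
      ∫⁻ z, M.extCost z ∂(Q : Measure (X × A)) ≤ π.avgCost p := by
  obtain ⟨N, P, Q, L, hL, hN, hP, hPN, hPL⟩ := π.exists_tendsto_occupation hSU p hJ
  have hπ (k : ℕ) : π.pairLaw p k M.graphᶜ = 0 :=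
    measure_compl_graph_of_lintegral_extCost_ne_top (π.lintegral_extCost_pairLaw_ne_top p hJ k)
  refine ⟨Q, ?_, ?_⟩
  · have : IsProbabilityMeasure (M.trans ∘ₘ (Q : Measure (X × A))) := inferInstance
    refine Measure.ext_of_forall_lintegral_le fun f => ?_
    have hf (x : X) : (f x : ℝ≥0∞) ≤ nndist f 0 :=
      ENNReal.coe_le_coe.2 (BoundedContinuousFunction.NNReal.upper_bound f x)
    have hfm : Measurable fun x => (f x : ℝ≥0∞) := by fun_prop
    have hfst : Tendsto (fun n => ∫⁻ z, f z.1 ∂(P n : Measure (X × A))) atTop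
        (𝓝 (∫⁻ z, f z.1 ∂(Q : Measure (X × A)))) :=
      (ProbabilityMeasure.tendsto_iff_forall_lintegral_tendsto.1 hP)
        (f.compContinuous ⟨Prod.fst, continuous_fst⟩)
    have hrem : Tendsto (fun n => ((N n : ℕ) : ℝ≥0∞)⁻¹ * (nndist f 0 : ℝ≥0∞)) atTop (𝓝 0) := by
      have := ENNReal.Tendsto.mul_const (b := (nndist f 0 : ℝ≥0∞))
        (ENNReal.tendsto_inv_nat_nhds_zero.comp hN) (Or.inr ENNReal.coe_ne_top)
      simpa using this
    rw [Measure.lintegral_bind (Kernel.aemeasurable _) hfm.aemeasurable, Measure.fst,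
      lintegral_map hfm measurable_fst]
    calc ∫⁻ z, ∫⁻ x, f x ∂M.trans z ∂(Q : Measure (X × A))
        ≤ liminf (fun n => ∫⁻ z, ∫⁻ x, f x ∂M.trans z ∂(P n : Measure (X × A))) atTop := by
          refine π.lintegral_le_liminf_occupation hSU hM p hπ hP hPN hL hPL
            (Measurable.lintegral_kernel hfm) (b := nndist f 0) ENNReal.coe_ne_top
            (fun z => ?_) fun D hcont _ =>
              (continuousOn_lintegral_trans hcont f).lowerSemicontinuousOn
          calc ∫⁻ x, f x ∂M.trans z ≤ ∫⁻ _, nndist f 0 ∂M.trans z := lintegral_mono hf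
            _ = nndist f 0 := by simp
      _ ≤ liminf (fun n => ∫⁻ z, f z.1 ∂(P n : Measure (X × A)) +
            ((N n : ℕ) : ℝ≥0∞)⁻¹ * nndist f 0) atTop := by
          refine liminf_le_liminf (.of_forall fun n => ?_)
          simp only [hPN]
          exact π.lintegral_trans_occupation_le p (N n) hfm hf
      _ = ∫⁻ z, f z.1 ∂(Q : Measure (X × A)) := by
          simpa using (hfst.add hrem).liminf_eq
  -- Fatou needs a bounded integrand; `min c j` keeps lower semicontinuity on `D × A`, and monotone
  -- convergence removes `j`.
  · have htrunc (j : ℕ) : ∫⁻ z, min (M.extCost z) j ∂(Q : Measure (X × A)) ≤ π.avgCost p := by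
      calc ∫⁻ z, min (M.extCost z) j ∂(Q : Measure (X × A))
          ≤ liminf (fun n => ∫⁻ z, min (M.extCost z) j ∂(P n : Measure (X × A))) atTop :=
            π.lintegral_le_liminf_occupation hSU hM p hπ hP hPN hL hPL
              (M.measurable_extCost.min measurable_const) (ENNReal.natCast_ne_top j)
              (fun z => min_le_right _ _) fun D _ hcost =>
                hcost.inf lowerSemicontinuousOn_const
        _ ≤ limsup (fun n => ∫⁻ z, min (M.extCost z) j ∂(P n : Measure (X × A))) atTop :=
            liminf_le_limsup
        _ ≤ limsup (fun n => π.nStageCost p (N n) / (N n : ℝ≥0∞)) atTop := by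
            refine limsup_le_limsup (.of_forall fun n => ?_)
            simp only [hPN, ← π.lintegral_extCost_occupation]
            exact lintegral_mono fun z => min_le_left _ _
        _ ≤ π.avgCost p := limsup_le_limsup_of_le (u := fun n : ℕ => π.nStageCost p n / n) hN
    have hsup (z : X × A) : M.extCost z = ⨆ j : ℕ, min (M.extCost z) j := by
      rw [← inf_iSup_eq, ENNReal.iSup_natCast, inf_top_eq]
    rw [lintegral_congr hsup, lintegral_iSup (fun j => M.measurable_extCost.min measurable_const)
      fun i j hij z => min_le_min_left _ (Nat.cast_le.2 hij)]
    exact iSup_le htrunc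

end Limit

end MDP

/-! ### Conclusion. -/

theorem mainTheorem4 {X : Type u} {A : Type v}
    [TopologicalSpace X] [IsTopBorelSpace X] [MeasurableSpace X] [BorelSpace X]
    [TopologicalSpace A] [DiscreteTopology A] [Countable A] [MeasurableSpace A] [BorelSpace A]
    (M : MDP X A) (hG : M.CondG)
    (K : ℕ → Set X) (F : ℕ → Set A) (hSU : M.CondSU K F) (hM : ∀ n, M.CondM (K n))
    (π : M.Policy) (p : Measure X) [IsProbabilityMeasure p] (hJ : π.avgCost p < ⊤) :
    ∃ (μ : M.StationaryPolicy) (p' : Measure X) (_ : IsProbabilityMeasure p'),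
      μ.chain.Invariant p' ∧ μ.toPolicy.avgCost p' ≤ π.avgCost p := by
  obtain ⟨Y, _, _, f, hf, -⟩ := IsTopBorelSpace.exists_isEmbedding (X := X)
  have : TopologicalSpace.MetrizableSpace X := hf.metrizableSpace
  have : SecondCountableTopology X := hf.secondCountableTopology
  obtain ⟨Q, hQinv, hQcost⟩ := π.exists_invariant_occupation hSU hM p hJ
  obtain ⟨μ, hμ⟩ := M.exists_stationaryPolicy_compProd_eq (Q : Measure (X × A))
    (MDP.measure_compl_graph_of_lintegral_extCost_ne_top (hQcost.trans_lt hJ).ne)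
  -- As `Q.fst ⊗ₘ μ.kernel = Q`, one step of the chain sends `Q.fst` to `M.trans ∘ₘ Q = Q.fst`.
  have hinv : μ.chain.Invariant (Q : Measure (X × A)).fst := by
    rw [Kernel.Invariant, μ.chain_comp, hμ, hQinv]
  refine ⟨μ, (Q : Measure (X × A)).fst, inferInstance, hinv, ?_⟩
  rw [μ.avgCost_of_invariant _ hinv, hμ]
  exact hQcost
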